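/- Let $T\in[1,+\infty]$ be the random running time of a Las Vegas algorithm, with law $p$. A cutoff (restart) sequence is a sequence $S=(S_k)_{k\ge 0}\in[1,+\infty)^{\mathbb N}$. The multi-start algorithm with cutoffs $S$ runs the algorithm afresh, the $k$-th time for at most a time $S_k$, until a run terminates. If $(T_k)_{k\ge 0}$ are the i.i.d. running times (of law $p$) of the successive runs and $K^\star=\min\{k\ge 0: T_k\le S_k\}$, its expected running time is $$\underline{L}_S(p)=\mathbb E\Big[\sum_{k=0}^{K^\star-1}S_k+T_{K^\star}\Big],$$ the quantity inside the expectation being $+\infty$ when no run terminates before its cutoff. If $S$ is random, it is independent of $(T_k)_{k\ge 0}$ and the expectation is also over $S$. For a continuous (strictly) increasing $\phi:[1,+\infty)\to\mathbb R_+$, extended by $\phi(+\infty)=\lim_{t\to+\infty}\phi(t)\in[0,+\infty]$, let $\mu_\phi(T)=\phi^{-1}(\mathbb E[\phi(T)])\in[1,+\infty]$, where $T\sim p$. **Theorem.** Let $\phi:[1,+\infty)\to\mathbb R_+$ be a (strictly) increasing and twice differentiable function such that $$\limsup_{t\to+\infty}\frac{t\,\phi''(t)}{\phi'(t)}<-2,$$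 where the limsup is taken in $[-\infty,+\infty]$. Then there exist no sequence $S\in[1,+\infty)^{\mathbb N}$ and constant $C>0$ such that, for every probability distribution $p$ on $[1,+\infty]$, $\underline{L}_S(p)\le C\,\mu_\phi(T)$ with $T\sim p$. The same holds for random sequences: there exist no random sequence $S$ with values in $[1,+\infty)^{\mathbb N}$ and constant $C>0$ such that $\underline{L}_S(p)\le C\,\mu_\phi(T)$ for every such $p$. -/

import Mathlib

open MeasureTheory Filter Set
open scoped ENNReal

/-- The index `K⋆ = min {k : t k ≤ S k}` of the last run of the multi-start algorithm, when the
`k`-th run of the underlying algorithm takes time `t k` and has cutoff `S k`.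
(Only used when some run terminates before its cutoff.) -/
noncomputable def lastRun (S : ℕ → ℝ) (t : ℕ → ℝ≥0∞) : ℕ :=
  sInf {k | t k ≤ ENNReal.ofReal (S k)}

open Classical in
/-- The running time of the multi-start algorithm with cutoffs `S` when the successive runs take
times `t`: the cutoffs of all the interrupted runs, plus the duration of the run that terminates.
It is infinite when no run terminates before its cutoff. -/
noncomputable def restartTime (S : ℕ → ℝ) (t : ℕ → ℝ≥0∞) : ℝ≥0∞ :=
  if ∃ k, t k ≤ ENNReal.ofReal (S k) then
    (∑ k ∈ Finset.range (lastRun S t), ENNReal.ofReal (S k)) + t (lastRun S t)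
  else ⊤

/-- Expected running time of the multi-start algorithm with the fixed cutoff sequence `S`, when the
running times of the successive runs are independent with common law `p`. -/
noncomputable def expectedRestartTime (S : ℕ → ℝ) (p : Measure ℝ≥0∞) [IsProbabilityMeasure p] :
    ℝ≥0∞ :=
  ∫⁻ t, restartTime S t ∂(Measure.infinitePi fun _ : ℕ => p)

/-- Expected running time of the multi-start algorithm with a random cutoff sequence of law `σ`,
drawn independently of the running times of the runs. -/
noncomputable def expectedRestartTimeRandom (σ : Measure (ℕ → ℝ)) (p : Measure ℝ≥0∞)
    [IsProbabilityMeasure p] : ℝ≥0∞ :=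
  ∫⁻ S, expectedRestartTime S p ∂σ

open Classical in
/-- The extension of an increasing function `φ : [1, ∞) → [0, ∞)` to `[1, ∞]`, with
`φ(∞) = lim φ = sup φ`. -/
noncomputable def extendTop (φ : ℝ → ℝ) (t : ℝ≥0∞) : ℝ≥0∞ :=
  if t = ⊤ then ⨆ x ∈ Ici (1 : ℝ), ENNReal.ofReal (φ x) else ENNReal.ofReal (φ t.toReal)

/-- `μ_φ(T) = φ⁻¹(E[φ(T)])` for `T` of law `p` on `[1, ∞]`, where `φ⁻¹` is the inverse of
`φ : [1, ∞] → [0, ∞]` on its image. -/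
noncomputable def phiMean (φ : ℝ → ℝ) (p : Measure ℝ≥0∞) : ℝ≥0∞ :=
  Function.invFunOn (extendTop φ) (Ici 1) (∫⁻ t, extendTop φ t ∂p)

/-! The obstruction is an algorithm that either stops at time `1`, with probability `q`, or never.
Cutoffs at least `1` cannot help: each failed run costs at least `1`, so the expected cost is at
least `(1 - q) / q`, whatever the sequence (`le_expectedRestartTime`). The condition on `φ` makes
`φ` bounded, with limit `L` and `t * (L - φ t)` arbitrarily small (`exists_limit_sub_lt_div`).
Choosing `q` proportional to `L - φ t` makes the `φ`-mean equal to `t`, while `q * t` is as small as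
desired, so `(1 - q) / q` exceeds `C * t`. -/

open Real in
/-- If `t φ''(t) / φ'(t)` stays below `-a` with `a > 1`, then `φ(∞) - φ(t) = O(t ^ (1 - a))`. -/
lemma exists_sub_le_rpow {φ φ' φ'' : ℝ → ℝ} {a t₀ : ℝ} (ha : 1 < a) (ht₀ : 1 ≤ t₀)
    (hφ' : ∀ t ∈ Ici (1 : ℝ), HasDerivWithinAt φ (φ' t) (Ici 1) t)
    (hφ'' : ∀ t ∈ Ici (1 : ℝ), HasDerivWithinAt φ' (φ'' t) (Ici 1) t)
    (hineq : ∀ t, t₀ ≤ t → t * φ'' t + a * φ' t ≤ 0) :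
    ∃ B : ℝ, ∀ t s, t₀ ≤ t → t ≤ s → φ s ≤ φ t + B * t ^ (1 - a) := by
  have hsub : Ici t₀ ⊆ Ici 1 := Ici_subset_Ici.2 ht₀
  -- The derivative is `t ^ (a - 1) * (t * φ'' t + a * φ' t)`.
  have hanti : AntitoneOn (fun t => t ^ a * φ' t) (Ici t₀) := by
    have hd : ∀ x ∈ Ici t₀, HasDerivWithinAt (fun t => t ^ a * φ' t)
        (a * x ^ (a - 1) * φ' x + x ^ a * φ'' x) (Ici t₀) x := fun x hx =>
      (hasDerivAt_rpow_const (Or.inl (by have : t₀ ≤ x := hx; linarith))).hasDerivWithinAt.mul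
        ((hφ'' x (hsub hx)).mono hsub)
    refine antitoneOn_of_hasDerivWithinAt_nonpos (convex_Ici _)
      (fun x hx => (hd x hx).continuousWithinAt)
      (fun x hx => (hd x (interior_subset hx)).mono interior_subset) fun x hx => ?_
    have hx : t₀ ≤ x := (interior_subset hx : x ∈ Ici t₀)
    have hx0 : 0 < x := by linarith
    have e : x ^ a = x ^ (a - 1) * x := by
      rw [← rpow_add_one hx0.ne']; ring_nf
    have := mul_nonpos_of_nonneg_of_nonpos (rpow_nonneg hx0.le (a - 1)) (hineq x hx)
    rw [e]; linarith
  set A := t₀ ^ a * φ' t₀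
  have hle : ∀ t, t₀ ≤ t → φ' t ≤ A * t ^ (-a) := by
    intro t ht
    have ht0 : 0 < t := by linarith
    have h := hanti (mem_Ici.2 le_rfl) (mem_Ici.2 ht) ht
    rw [rpow_neg ht0.le, ← div_eq_mul_inv, le_div_iff₀ (rpow_pos_of_pos ht0 a), mul_comm]
    exact h
  have hanti' : AntitoneOn (fun t => φ t + A / (a - 1) * t ^ (1 - a)) (Ici t₀) := by
    have hd : ∀ x ∈ Ici t₀, HasDerivWithinAt (fun t => φ t + A / (a - 1) * t ^ (1 - a))
        (φ' x + A / (a - 1) * ((1 - a) * x ^ (1 - a - 1))) (Ici t₀) x := fun x hx =>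
      ((hφ' x (hsub hx)).mono hsub).add (((hasDerivAt_rpow_const
        (Or.inl (by have : t₀ ≤ x := hx; linarith))).const_mul _).hasDerivWithinAt)
    refine antitoneOn_of_hasDerivWithinAt_nonpos (convex_Ici _)
      (fun x hx => (hd x hx).continuousWithinAt)
      (fun x hx => (hd x (interior_subset hx)).mono interior_subset) fun x hx => ?_
    have hx : t₀ ≤ x := (interior_subset hx : x ∈ Ici t₀)
    have h := hle x hx
    have ha' : a - 1 ≠ 0 := by linarith
    have e : A / (a - 1) * ((1 - a) * x ^ (1 - a - 1)) = -(A * x ^ (-a)) := by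
      rw [show (1 : ℝ) - a - 1 = -a by ring]; field_simp; ring
    rw [e]; linarith
  -- The sign of `A` is not known here, so this constant bounds the terms at `t` and at `s`
  -- separately.
  refine ⟨max (A / (a - 1)) 0 + |A / (a - 1)|, fun t s ht hts => ?_⟩
  have h := hanti' (mem_Ici.2 ht) (mem_Ici.2 (ht.trans hts)) hts
  have ht0 : 0 < t := by linarith
  have hs : s ^ (1 - a) ≤ t ^ (1 - a) := rpow_le_rpow_of_nonpos ht0 hts (by linarith)
  have hs0 : 0 ≤ s ^ (1 - a) := rpow_nonneg (ht0.le.trans hts) _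
  have h1 : A / (a - 1) * t ^ (1 - a) ≤ max (A / (a - 1)) 0 * t ^ (1 - a) :=
    mul_le_mul_of_nonneg_right (le_max_left _ _) (hs0.trans hs)
  have h2 : -(A / (a - 1)) * s ^ (1 - a) ≤ |A / (a - 1)| * t ^ (1 - a) :=
    mul_le_mul (neg_le_abs _) hs hs0 (abs_nonneg _)
  simp only at h
  linarith

/-- A nonnegative increasing function with `limsup t φ''(t) / φ'(t) < -2` has a finite
limit at infinity, which it approaches faster than `1 / t`. -/
lemma exists_limit_sub_lt_div {φ φ' φ'' : ℝ → ℝ}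
    (hφ_nonneg : ∀ t ∈ Ici (1 : ℝ), 0 ≤ φ t)
    (hφ_mono : StrictMonoOn φ (Ici 1))
    (hφ' : ∀ t ∈ Ici (1 : ℝ), HasDerivWithinAt φ (φ' t) (Ici 1) t)
    (hφ'' : ∀ t ∈ Ici (1 : ℝ), HasDerivWithinAt φ' (φ'' t) (Ici 1) t)
    (hlim : limsup (fun t : ℝ => ((t * φ'' t / φ' t : ℝ) : EReal)) atTop < ((-2 : ℝ) : EReal)) :
    ∃ L : ℝ, extendTop φ ⊤ = ENNReal.ofReal L ∧ (∀ t ∈ Ici (1 : ℝ), φ t < L) ∧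
      ∀ ε > 0, ∃ t, 1 ≤ t ∧ t * (L - φ t) < ε := by
  obtain ⟨b, hb, hb2⟩ := EReal.lt_iff_exists_real_btwn.1 hlim
  have hb2 : b < -2 := EReal.coe_lt_coe_iff.1 hb2
  obtain ⟨t₁, ht₁⟩ := eventually_atTop.1 (eventually_lt_of_limsup_lt hb)
  have hineq : ∀ t, max t₁ 1 ≤ t → t * φ'' t + (-b) * φ' t ≤ 0 := by
    intro t ht
    have h : t * φ'' t / φ' t < b := EReal.coe_lt_coe_iff.1 (ht₁ t ((le_max_left _ _).trans ht))
    have h1 : (1 : ℝ) ≤ t := (le_max_right _ _).trans ht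
    have hnn : 0 ≤ φ' t := by
      rw [← (hφ' t h1).derivWithin (uniqueDiffOn_Ici 1 t h1)]
      exact hφ_mono.monotoneOn.derivWithin_nonneg
    -- At a zero of `φ'` the quotient is `0` by convention, which is not below `b < -2`.
    have hne : φ' t ≠ 0 := by
      intro h0; rw [h0, div_zero] at h; linarith
    have := (div_lt_iff₀ (lt_of_le_of_ne hnn hne.symm)).1 h
    linarith
  obtain ⟨B, hB⟩ := exists_sub_le_rpow (by linarith) (le_max_right _ _) hφ' hφ'' hineq
  set t₀ := max t₁ 1
  have ht₀ : 1 ≤ t₀ := le_max_right _ _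
  have hup : ∀ t, t₀ ≤ t → ∀ s ∈ Ici (1 : ℝ), φ s ≤ φ t + B * t ^ (1 - -b) := by
    intro t ht s hs
    rcases le_total t s with h | h
    · exact hB t s ht h
    · exact (hφ_mono.monotoneOn hs (mem_Ici.2 (ht₀.trans ht)) h).trans (hB t t ht le_rfl)
  have hE : ∀ t, t₀ ≤ t → extendTop φ ⊤ ≤ ENNReal.ofReal (φ t + B * t ^ (1 - -b)) := by
    intro t ht
    rw [extendTop, if_pos rfl]
    exact iSup₂_le fun s hs => ENNReal.ofReal_le_ofReal (hup t ht s hs)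
  have hfin : extendTop φ ⊤ ≠ ⊤ := ne_top_of_le_ne_top ENNReal.ofReal_ne_top (hE t₀ le_rfl)
  have hge : ∀ t ∈ Ici (1 : ℝ), φ t ≤ (extendTop φ ⊤).toReal := by
    intro t ht
    rw [← ENNReal.ofReal_le_iff_le_toReal hfin, extendTop, if_pos rfl]
    exact le_iSup₂_of_le t ht le_rfl
  refine ⟨(extendTop φ ⊤).toReal, (ENNReal.ofReal_toReal hfin).symm, fun t ht => ?_,
    fun ε hε => ?_⟩
  · have ht1 : t + 1 ∈ Ici (1 : ℝ) := by have : 1 ≤ t := ht; exact mem_Ici.2 (by linarith)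
    exact (hφ_mono ht ht1 (by linarith)).trans_le (hge _ ht1)
  -- The threshold `-2` enters here: multiplying the `t ^ (1 + b)` decay by `t` still leaves a
  -- negative exponent.
  · have htend : Tendsto (fun t : ℝ => B * t ^ (-(-b - 2))) atTop (nhds 0) := by
      simpa using (tendsto_rpow_neg_atTop (show 0 < -b - 2 by linarith)).const_mul B
    obtain ⟨t, ht, ht'⟩ := ((htend.eventually (gt_mem_nhds hε)).and (eventually_ge_atTop t₀)).exists
    have ht1 : 1 ≤ t := ht₀.trans ht'
    have ht0 : 0 < t := by linarith
    refine ⟨t, ht1, lt_of_le_of_lt ?_ ht⟩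
    have h0 : 0 ≤ φ t + B * t ^ (1 - -b) :=
      (hφ_nonneg t ht1).trans (hup t ht' t ht1)
    have h := ENNReal.toReal_le_of_le_ofReal h0 (hE t ht')
    have e : t ^ (-(-b - 2)) = t * t ^ (1 - -b) := by
      rw [mul_comm, ← Real.rpow_add_one ht0.ne']; ring_nf
    rw [e, mul_left_comm]
    exact mul_le_mul_of_nonneg_left (by linarith) ht0.le

/-- With cutoffs at least `1`, the running time exceeds the number of initial runs that never
terminate. -/
lemma tsum_indicator_le_restartTime {S : ℕ → ℝ} (hS : ∀ k, 1 ≤ S k) (t : ℕ → ℝ≥0∞) :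
    ∑' n : ℕ, ((Finset.range (n + 1) : Set ℕ).pi fun _ => {⊤}).indicator (1 : (ℕ → ℝ≥0∞) → ℝ≥0∞) t
      ≤ restartTime S t := by
  unfold restartTime
  split_ifs with h
  · have hK : t (lastRun S t) ≤ ENNReal.ofReal (S (lastRun S t)) := Nat.sInf_mem h
    have hfin : t (lastRun S t) ≠ ⊤ := ne_top_of_le_ne_top ENNReal.ofReal_ne_top hK
    have hsupp : ∀ n ∉ Finset.range (lastRun S t),
        ((Finset.range (n + 1) : Set ℕ).pi fun _ => {⊤}).indicator
          (1 : (ℕ → ℝ≥0∞) → ℝ≥0∞) t = 0 := by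
      intro n hn
      refine indicator_of_notMem (fun hmem => hfin ?_) _
      -- For `n` at least the last run, `range (n + 1)` contains that run, whose time is finite.
      exact hmem _ (by simp at hn ⊢; omega)
    rw [tsum_eq_sum hsupp]
    refine le_add_right (Finset.sum_le_sum fun k _ => ?_)
    refine (indicator_le_self' (fun _ _ => zero_le) t).trans ?_
    simpa using hS k
  · exact le_top

/-- The expected running time is at least `r + r² + ⋯ = r / (1 - r)`, where `r` is the probability
that a run never terminates. -/
lemma le_expectedRestartTime {S : ℕ → ℝ} (hS : ∀ k, 1 ≤ S k) (p : Measure ℝ≥0∞)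
    [IsProbabilityMeasure p] : p {⊤} * (1 - p {⊤})⁻¹ ≤ expectedRestartTime S p := by
  have hmeas : ∀ n : ℕ,
      MeasurableSet ((Finset.range (n + 1) : Set ℕ).pi fun _ => ({⊤} : Set ℝ≥0∞)) := fun n =>
    MeasurableSet.pi (Finset.countable_toSet _) fun _ _ => measurableSet_singleton _
  refine le_trans (le_of_eq ?_) (lintegral_mono (tsum_indicator_le_restartTime hS))
  rw [lintegral_tsum fun n => (measurable_one.indicator (hmeas n)).aemeasurable]
  simp_rw [lintegral_indicator_one (hmeas _)]
  rw [← ENNReal.tsum_geometric, ← ENNReal.tsum_mul_left]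
  refine tsum_congr fun n => ?_
  rw [Measure.infinitePi_pi _ fun _ _ => measurableSet_singleton _, Finset.prod_const,
    Finset.card_range, pow_succ']

/-- The law of a running time equal to `1` with probability `q` and infinite otherwise. -/
noncomputable def oneOrTop (q : ℝ) : Measure ℝ≥0∞ :=
  ENNReal.ofReal q • Measure.dirac 1 + ENNReal.ofReal (1 - q) • Measure.dirac ⊤

lemma isProbabilityMeasure_oneOrTop {q : ℝ} (h0 : 0 ≤ q) (h1 : q ≤ 1) :
    IsProbabilityMeasure (oneOrTop q) := by
  constructor
  simp only [oneOrTop, Measure.add_apply, Measure.smul_apply, measure_univ, smul_eq_mul, mul_one]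
  rw [← ENNReal.ofReal_add h0 (by linarith)]
  simp

lemma ae_one_le_oneOrTop (q : ℝ) : ∀ᵐ t ∂(oneOrTop q), 1 ≤ t := by
  rw [oneOrTop, ae_add_measure_iff]
  exact ⟨Measure.ae_smul_measure (by simp [ae_dirac_eq]) _,
    Measure.ae_smul_measure (by simp [ae_dirac_eq]) _⟩

lemma oneOrTop_singleton_top (q : ℝ) : oneOrTop q {⊤} = ENNReal.ofReal (1 - q) := by
  simp [oneOrTop]

/-- `μ_φ(T) = t` as soon as `E[φ(T)] = φ(t)`. -/
lemma phiMean_eq_ofReal {φ : ℝ → ℝ} {p : Measure ℝ≥0∞} {L t : ℝ}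
    (hφ_nonneg : ∀ t ∈ Ici (1 : ℝ), 0 ≤ φ t) (hφ_mono : StrictMonoOn φ (Ici 1))
    (hL : extendTop φ ⊤ = ENNReal.ofReal L) (hlt : φ t < L) (ht : 1 ≤ t)
    (h : ∫⁻ x, extendTop φ x ∂p = ENNReal.ofReal (φ t)) :
    phiMean φ p = ENNReal.ofReal t := by
  have ht0 : 0 ≤ t := by linarith
  have hex : ∃ s ∈ Ici (1 : ℝ≥0∞), extendTop φ s = ENNReal.ofReal (φ t) :=
    ⟨ENNReal.ofReal t, by simpa using ht, by simp [extendTop, ENNReal.toReal_ofReal ht0]⟩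
  rw [phiMean, h]
  have hmem : 1 ≤ Function.invFunOn (extendTop φ) (Ici 1) (ENNReal.ofReal (φ t)) :=
    Function.invFunOn_mem hex
  have heq := Function.invFunOn_eq hex
  set s := Function.invFunOn (extendTop φ) (Ici 1) (ENNReal.ofReal (φ t))
  have hs : s ≠ ⊤ := by
    intro hs
    rw [hs, hL, ENNReal.ofReal_eq_ofReal_iff ((hφ_nonneg t ht).trans hlt.le) (hφ_nonneg t ht)]
      at heq
    exact hlt.ne' heq
  have hs1 : s.toReal ∈ Ici (1 : ℝ) := by simpa using ENNReal.toReal_mono hs hmem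
  rw [extendTop, if_neg hs,
    ENNReal.ofReal_eq_ofReal_iff (hφ_nonneg _ hs1) (hφ_nonneg t ht)] at heq
  rw [← hφ_mono.injOn hs1 ht heq, ENNReal.ofReal_toReal hs]

/-- For every constant `C` there is a law `p` of running times for which `C * μ_φ(T)` is beaten
by a lower bound valid for all cutoff sequences. -/
lemma exists_law_phiMean_lt {φ φ' φ'' : ℝ → ℝ}
    (hφ_nonneg : ∀ t ∈ Ici (1 : ℝ), 0 ≤ φ t)
    (hφ_mono : StrictMonoOn φ (Ici 1))
    (hφ' : ∀ t ∈ Ici (1 : ℝ), HasDerivWithinAt φ (φ' t) (Ici 1) t)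
    (hφ'' : ∀ t ∈ Ici (1 : ℝ), HasDerivWithinAt φ' (φ'' t) (Ici 1) t)
    (hlim : limsup (fun t : ℝ => ((t * φ'' t / φ' t : ℝ) : EReal)) atTop < ((-2 : ℝ) : EReal))
    {C : ℝ} (hC : 0 < C) :
    ∃ p : Measure ℝ≥0∞, IsProbabilityMeasure p ∧ (∀ᵐ t ∂p, 1 ≤ t) ∧
      ENNReal.ofReal C * phiMean φ p < p {⊤} * (1 - p {⊤})⁻¹ := by
  obtain ⟨L, hL, hlt, hsmall⟩ := exists_limit_sub_lt_div hφ_nonneg hφ_mono hφ' hφ'' hlim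
  have h1 : (1 : ℝ) ∈ Ici (1 : ℝ) := mem_Ici.2 le_rfl
  have hD : 0 < L - φ 1 := sub_pos.2 (hlt 1 h1)
  -- This yields `(C + 1) * t * q < 1`; the extra `t * q ≥ q` then gives `C * t * q < 1 - q`.
  obtain ⟨t, ht, hts⟩ := hsmall ((L - φ 1) / (C + 1)) (by positivity)
  have ht0 : 0 < t := by linarith
  -- The solution of `q * φ 1 + (1 - q) * L = φ t`.
  set q := (L - φ t) / (L - φ 1) with hq
  have hq0 : 0 < q := div_pos (sub_pos.2 (hlt t ht)) hD
  have hq1 : q ≤ 1 := (div_le_one hD).2 (by linarith [hφ_mono.monotoneOn h1 ht ht])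
  have hqt : (C + 1) * t * q < 1 := by
    rw [lt_div_iff₀ (by linarith)] at hts
    rw [hq, ← mul_div_assoc, div_lt_one hD]
    linarith
  have hL0 : 0 ≤ L := (hφ_nonneg 1 h1).trans (hlt 1 h1).le
  have hint : ∫⁻ x, extendTop φ x ∂(oneOrTop q) = ENNReal.ofReal (φ t) := by
    have e : φ t = q * φ 1 + (1 - q) * L := by
      have : q * (L - φ 1) = L - φ t := div_mul_cancel₀ _ hD.ne'
      linarith
    have e1 : extendTop φ 1 = ENNReal.ofReal (φ 1) := by simp [extendTop]
    rw [oneOrTop, lintegral_add_measure, lintegral_smul_measure, lintegral_smul_measure,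
      lintegral_dirac, lintegral_dirac, hL, e1, smul_eq_mul, smul_eq_mul,
      ← ENNReal.ofReal_mul hq0.le, ← ENNReal.ofReal_mul (by linarith),
      ← ENNReal.ofReal_add (mul_nonneg hq0.le (hφ_nonneg 1 h1))
        (mul_nonneg (by linarith) hL0), ← e]
  refine ⟨oneOrTop q, isProbabilityMeasure_oneOrTop hq0.le hq1, ae_one_le_oneOrTop q, ?_⟩
  rw [phiMean_eq_ofReal hφ_nonneg hφ_mono hL (hlt t ht) ht hint, oneOrTop_singleton_top,
    ← ENNReal.ofReal_one, ← ENNReal.ofReal_sub _ (by linarith), sub_sub_cancel,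
    ← ENNReal.ofReal_inv_of_pos hq0, ← ENNReal.ofReal_mul hC.le,
    ← ENNReal.ofReal_mul (by linarith), ← div_eq_mul_inv]
  have hkey : C * t < (1 - q) / q := by
    rw [lt_div_iff₀ hq0]
    nlinarith [mul_le_mul_of_nonneg_right ht hq0.le]
  exact (ENNReal.ofReal_lt_ofReal_iff ((by positivity : 0 < C * t).trans hkey)).2 hkey

theorem mainTheorem2 (φ φ' φ'' : ℝ → ℝ)
    (hφ_nonneg : ∀ t ∈ Ici (1 : ℝ), 0 ≤ φ t)
    (hφ_mono : StrictMonoOn φ (Ici 1))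
    (hφ' : ∀ t ∈ Ici (1 : ℝ), HasDerivWithinAt φ (φ' t) (Ici 1) t)
    (hφ'' : ∀ t ∈ Ici (1 : ℝ), HasDerivWithinAt φ' (φ'' t) (Ici 1) t)
    (hlim : limsup (fun t : ℝ => ((t * φ'' t / φ' t : ℝ) : EReal)) atTop < ((-2 : ℝ) : EReal)) :
    (¬ ∃ (S : ℕ → ℝ) (C : ℝ), (∀ k, 1 ≤ S k) ∧ 0 < C ∧
      ∀ (p : Measure ℝ≥0∞) [IsProbabilityMeasure p], (∀ᵐ t ∂p, 1 ≤ t) →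
        expectedRestartTime S p ≤ ENNReal.ofReal C * phiMean φ p) ∧
    (¬ ∃ (σ : Measure (ℕ → ℝ)) (C : ℝ), IsProbabilityMeasure σ ∧ (∀ᵐ S ∂σ, ∀ k, 1 ≤ S k) ∧ 0 < C ∧
      ∀ (p : Measure ℝ≥0∞) [IsProbabilityMeasure p], (∀ᵐ t ∂p, 1 ≤ t) →
        expectedRestartTimeRandom σ p ≤ ENNReal.ofReal C * phiMean φ p) := by
  constructor
  · rintro ⟨S, C, hS, hC, h⟩
    obtain ⟨p, hp, hp1, hlt⟩ := exists_law_phiMean_lt hφ_nonneg hφ_mono hφ' hφ'' hlim hC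
    exact ((le_expectedRestartTime hS p).trans (h p hp1)).not_gt hlt
  · rintro ⟨σ, C, hσ, hS, hC, h⟩
    obtain ⟨p, hp, hp1, hlt⟩ := exists_law_phiMean_lt hφ_nonneg hφ_mono hφ' hφ'' hlim hC
    have hle : p {⊤} * (1 - p {⊤})⁻¹ ≤ expectedRestartTimeRandom σ p := by
      -- The lower bound does not depend on `S`, so it survives averaging over `σ`.
      have := lintegral_mono_ae (μ := σ) (f := fun _ => p {⊤} * (1 - p {⊤})⁻¹)
        (g := fun S => expectedRestartTime S p) (hS.mono fun S hS => le_expectedRestartTime hS p)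
      simpa [expectedRestartTimeRandom] using this
    exact (hle.trans (h p hp1)).not_gt hlt
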